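/- For $n\ge 1$ let $a_n=(1-2^{-4n})e^{i2^{-n}}$, let $\mathbb D=\{z\in\mathbb C:|z|<1\}$, $\mathbb T=\{z\in\mathbb C:|z|=1\}$, and $$B_1(z)=z\prod_{n=1}^{\infty}\frac{|a_n|}{a_n}\,\frac{a_n-z}{1-\overline{a_n}z},\qquad z\in\mathbb D .$$ A subproduct of $B_1$ is a function $z^k\prod_{n\in S}\frac{|a_n|}{a_n}\frac{a_n-z}{1-\overline{a_n}z}$ with $k\in\{0,1\}$ and $S\subseteq\{1,2,\dots\}$. A function $f$ on $\mathbb D$ has angular derivative $f'(\zeta)\in\mathbb C$ at $\zeta\in\mathbb T$ if it has a finite nontangential limit $f(\zeta)$ at $\zeta$ and $\frac{f(z)-f(\zeta)}{z-\zeta}\to f'(\zeta)$ as $z\to\zeta$ nontangentially. It has finite phase derivative at $e^{it}$ if $\lim_{r\to1^-}\frac{\partial}{\partial t}\arg f(re^{it})$ exists and is finite (in particular, for $r<1$ close to $1$, $f(re^{is})\ne0$ for $s$ near $t$, with a local branch of the argument differentiable at $t$). Let $\mathcal A$ be the class of functions $f$ analytic in $\mathbb D$ with $f(0)=0$, $f'(0)=1$,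 and let $\mathcal U$ be the class of $f\in\mathcal A$ that do not vanish in $\mathbb D\setminus\{0\}$ and satisfy $$\left|\left(\frac{z}{f(z)}\right)^2f'(z)-1\right|<1\quad\text{for } z\in\mathbb D$$ (where the expression inside the modulus is extended by its limit $0$ at $z=0$). Then $B_1$ is a Blaschke product: $0<|a_n|<1$ for all $n$, $\sum_n(1-|a_n|)<\infty$, and the product $\prod_{n\ge1}\frac{|a_n|}{a_n}\frac{a_n-z}{1-\overline{a_n}z}$ and all its subproducts converge locally uniformly in $\mathbb D$. Moreover: (a) $B_1$ and all its subproducts have a radial limit of modulus one at every point of $\mathbb T$; (b) $B_1$ has a finite angular derivative at every point of $\mathbb T$ and, for every $\zeta\in\mathbb T$, $|B_1(\zeta)|=1$, the number $\zeta B_1'(\zeta)/B_1(\zeta)$ is real, and $1<\frac{\zeta B_1'(\zeta)}{B_1(\zeta)}<\infty$; (c) $B_1$ has finite phase derivative at every point of $\mathbb T$; (d) the function $\frac{z}{(1-B_1(z))^2}$ belongs to $\mathcal A$ but not to $\mathcal U$. -/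

import Mathlib

open Filter Topology

noncomputable section

/-- The zero `a_n = (1 - 2^{-4n}) e^{i 2^{-n}}`, `n ≥ 1`. -/
def zeroSeq (n : ℕ+) : ℂ :=
  (1 - 1 / 2 ^ (4 * (n : ℕ)) : ℂ) * Complex.exp (Complex.I * (1 / 2 ^ (n : ℕ)))

/-- The Blaschke factor `(|a| / a) (a - z) / (1 - conj a * z)` of a point `a` of the punctured
unit disk. -/
def blaschkeFactor (a z : ℂ) : ℂ :=
  ((‖a‖ : ℝ) : ℂ) / a * ((a - z) / (1 - star a * z))

/-- `B₁(z) = z ∏_{n ≥ 1} (|a_n| / a_n) (a_n - z) / (1 - conj a_n * z)`. -/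
def blaschkeB₁ (z : ℂ) : ℂ :=
  z * ∏' n : ℕ+, blaschkeFactor (zeroSeq n) z

/-- The subproduct of `B₁` that keeps the factors with index in `S`, and the factor `z` or not
according as `k = 1` or `k = 0`. -/
def subproductB₁ (k : Fin 2) (S : Set ℕ+) (z : ℂ) : ℂ :=
  z ^ (k : ℕ) * ∏' n : S, blaschkeFactor (zeroSeq n) z

/-- `f` has radial limit `w` at the point `ζ` of the unit circle. -/
def HasRadialLimit (f : ℂ → ℂ) (ζ w : ℂ) : Prop :=
  Tendsto (fun r : ℝ => f ((r : ℂ) * ζ)) (𝓝[<] (1 : ℝ)) (𝓝 w)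

/-- `f` has angular (nontangential) limit `w` at the point `ζ` of the unit circle: the limit along
each Stolz region `{z : |z| < 1, |1 - z / ζ| < M (1 - |z / ζ|)}` with vertex `ζ`. -/
def HasAngularLimit (f : ℂ → ℂ) (ζ w : ℂ) : Prop :=
  ∀ M : ℝ, Tendsto f (𝓝[{z : ℂ | z / ζ ∈ Complex.stolzSet M}] ζ) (𝓝 w)

/-- At the point `ζ` of the unit circle, `f` has angular limit `w` and (finite) angular
derivative `c`. -/
def HasAngularDerivAt (f : ℂ → ℂ) (ζ w c : ℂ) : Prop :=
  HasAngularLimit f ζ w ∧ HasAngularLimit (fun z => (f z - w) / (z - ζ)) ζ c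

/-- `φ` is, near `t`, a branch of the argument of `s ↦ f (r e^{is})`. -/
def IsLocalPhase (f : ℂ → ℂ) (r t : ℝ) (φ : ℝ → ℝ) : Prop :=
  ∀ᶠ s : ℝ in 𝓝 t, f (r * Complex.exp (Complex.I * s)) ≠ 0 ∧
    f (r * Complex.exp (Complex.I * s)) =
      ((‖f (r * Complex.exp (Complex.I * s))‖ : ℝ) : ℂ) * Complex.exp (Complex.I * φ s)

/-- `f` has the (finite) phase derivative `L` at `e^{it}`: the limit, as `r → 1⁻`, of the
derivative at `t` of the phase of `s ↦ f (r e^{is})`. -/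
def HasPhaseDerivAt (f : ℂ → ℂ) (t L : ℝ) : Prop :=
  ∃ d : ℝ → ℝ,
    (∀ᶠ r : ℝ in 𝓝[<] (1 : ℝ), ∃ φ : ℝ → ℝ, IsLocalPhase f r t φ ∧ HasDerivAt φ (d r) t) ∧
    Tendsto d (𝓝[<] (1 : ℝ)) (𝓝 L)

/-- The class `𝒜` of functions analytic in the unit disk with `f(z) = z + a₂ z² + ⋯`. -/
def classA : Set (ℂ → ℂ) :=
  {f | AnalyticOnNhd ℂ f (Metric.ball 0 1) ∧ f 0 = 0 ∧ deriv f 0 = 1}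

/-- The class `𝒰(lam)` of those `f ∈ 𝒜` with `|(z / f(z))² f'(z) - 1| < lam` in the unit disk.
The expression extends analytically across `z = 0` with the value `0` there (as `z / f(z) → 1`
and `f'(0) = 1`), so for `lam > 0` the condition at the origin is void. The function `f` must not
vanish elsewhere. -/
def classU (lam : ℝ) : Set (ℂ → ℂ) :=
  {f | f ∈ classA ∧ ∀ z ∈ Metric.ball (0 : ℂ) 1, z ≠ 0 →
    f z ≠ 0 ∧ ‖(z / f z) ^ 2 * deriv f z - 1‖ < lam}

end

open Filter Topology

/-! Everything on the circle follows from Frostman's condition `∑ (1 - |a_n|²) / |ζ - a_n|² < ∞`,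
which holds at every `ζ`: the numerators are of order `16⁻ⁿ`, while `|ζ - a_n| ≥ c 2⁻ⁿ` eventually,
even at `ζ = 1` where the zeros accumulate (`summable_frostman_zeroSeq`).

`hasAngularDerivAt_tprod_blaschkeFactor` expands the quotient of the product at `z` by its value at
`ζ` into a telescoping sum and applies dominated convergence in Stolz regions. The logarithmic
derivative is then `ζ b'(ζ) / b(ζ) = σ`, with `σ` the Frostman sum; the extra factor `z` makes it `1
+ σ > 1`. The condition passes to subfamilies, hence the claim on subproducts. Cauchy's estimate
gives radial convergence of the derivative, hence the phase derivative.

For (d), write `B₁ = z b` and `g = b (z b - 2)`, so that `z / f = 1 + z g` and `(z / f)² f' - 1 =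
-z² g'`. Membership in `𝒰` would bound `g'`, but `g` falls too fast between `0` and the zero `a_1`.
-/

/-! ### Estimates for a single Blaschke factor. -/

lemma one_sub_star_mul_ne_zero {a z : ℂ} (ha : ‖a‖ < 1) (hz : ‖z‖ ≤ 1) : 1 - star a * z ≠ 0 := by
  intro h
  have h1 : ‖star a * z‖ = 1 := by rw [← sub_eq_zero.mp h, norm_one]
  rw [norm_mul, norm_star] at h1
  nlinarith [norm_nonneg a, norm_nonneg z]

lemma norm_one_sub_star_mul_eq {a ζ : ℂ} (hζ : ‖ζ‖ = 1) : ‖1 - star a * ζ‖ = ‖ζ - a‖ := by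
  have h : 1 - star a * ζ = ζ * star (ζ - a) := by
    have : ζ * star ζ = 1 := by
      have := Complex.mul_conj' ζ
      rw [hζ] at this
      simpa using this
    rw [star_sub, mul_sub, this]
    ring
  rw [h, norm_mul, norm_star, hζ, one_mul]

/-- The difference of the squares is `(1 - |a|²)(1 - |z|²)`. -/
lemma norm_sub_le_norm_one_sub_star_mul {a z : ℂ} (ha : ‖a‖ ≤ 1) (hz : ‖z‖ ≤ 1) :
    ‖a - z‖ ≤ ‖1 - star a * z‖ := by
  refine (pow_le_pow_iff_left₀ (norm_nonneg _) (norm_nonneg _) two_ne_zero).mp ?_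
  have ha2 : ‖a‖ ^ 2 ≤ 1 := pow_le_one₀ (norm_nonneg _) ha
  have hz2 : ‖z‖ ^ 2 ≤ 1 := pow_le_one₀ (norm_nonneg _) hz
  rw [← Complex.normSq_eq_norm_sq] at *
  rw [← Complex.normSq_eq_norm_sq] at *
  simp only [Complex.normSq_apply, Complex.sub_re, Complex.sub_im, Complex.mul_re, Complex.mul_im,
    Complex.star_def, Complex.conj_re, Complex.conj_im, Complex.one_re, Complex.one_im] at *
  nlinarith

lemma one_sub_norm_le_norm_one_sub_star_mul {a z : ℂ} (ha : ‖a‖ ≤ 1) :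
    1 - ‖z‖ ≤ ‖1 - star a * z‖ := by
  have h := norm_sub_norm_le (1 : ℂ) (star a * z)
  rw [norm_one, norm_mul, norm_star] at h
  nlinarith [norm_nonneg z]

lemma norm_ofReal_norm_div_self {a : ℂ} (ha : a ≠ 0) : ‖((‖a‖ : ℝ) : ℂ) / a‖ = 1 := by
  rw [norm_div, Complex.norm_real, norm_norm, div_self (norm_ne_zero_iff.mpr ha)]

lemma norm_blaschkeFactor_le_one {a z : ℂ} (ha0 : a ≠ 0) (ha : ‖a‖ < 1) (hz : ‖z‖ ≤ 1) :
    ‖blaschkeFactor a z‖ ≤ 1 := by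
  rw [blaschkeFactor, norm_mul, norm_ofReal_norm_div_self ha0, one_mul, norm_div]
  exact div_le_one_of_le₀ (norm_sub_le_norm_one_sub_star_mul ha.le hz) (norm_nonneg _)

lemma norm_blaschkeFactor_eq_one {a ζ : ℂ} (ha0 : a ≠ 0) (ha : ‖a‖ < 1) (hζ : ‖ζ‖ = 1) :
    ‖blaschkeFactor a ζ‖ = 1 := by
  rw [blaschkeFactor, norm_mul, norm_ofReal_norm_div_self ha0, one_mul, norm_div, norm_sub_rev,
    ← norm_one_sub_star_mul_eq hζ,
    div_self (norm_ne_zero_iff.mpr (one_sub_star_mul_ne_zero ha hζ.le))]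

/-- Source of all convergence of the products, both inside the disk and on the circle. -/
lemma norm_blaschkeFactor_sub_one_le {a z : ℂ} (ha0 : a ≠ 0) (ha : ‖a‖ < 1) (hz : ‖z‖ ≤ 1) :
    ‖blaschkeFactor a z - 1‖ ≤ 2 * (1 - ‖a‖) / ‖1 - star a * z‖ := by
  have h1 := one_sub_star_mul_ne_zero ha hz
  have h2 : blaschkeFactor a z - 1 =
      -((1 - ((‖a‖ : ℝ) : ℂ)) * (1 + ((‖a‖ : ℝ) : ℂ) / a * z)) / (1 - star a * z) := by
    have h3 : star a * a = ((‖a‖ : ℝ) : ℂ) ^ 2 := Complex.conj_mul' a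
    rw [blaschkeFactor]
    rw [mul_div_assoc', eq_div_iff h1, sub_mul, div_mul_cancel₀ _ h1]
    field_simp
    linear_combination z * h3
  rw [h2, norm_div, norm_neg, norm_mul]
  refine div_le_div_of_nonneg_right ?_ (norm_nonneg _)
  have h4 : ‖1 - ((‖a‖ : ℝ) : ℂ)‖ = 1 - ‖a‖ := by
    rw [← Complex.ofReal_one, ← Complex.ofReal_sub, Complex.norm_real, Real.norm_of_nonneg]
    linarith
  have h5 : ‖1 + ((‖a‖ : ℝ) : ℂ) / a * z‖ ≤ 2 := by
    refine (norm_add_le _ _).trans ?_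
    rw [norm_one, norm_mul, norm_ofReal_norm_div_self ha0]
    linarith
  rw [h4]
  nlinarith

lemma continuousOn_blaschkeFactor {a : ℂ} (ha : ‖a‖ < 1) :
    ContinuousOn (blaschkeFactor a) (Metric.closedBall 0 1) := by
  unfold blaschkeFactor
  refine continuousOn_const.mul (ContinuousOn.div (by fun_prop) (by fun_prop) fun z hz => ?_)
  exact one_sub_star_mul_ne_zero ha (by simpa using hz)

lemma differentiableOn_blaschkeFactor {a : ℂ} (ha : ‖a‖ < 1) :
    DifferentiableOn ℂ (blaschkeFactor a) (Metric.ball 0 1) := by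
  unfold blaschkeFactor
  refine DifferentiableOn.const_mul (DifferentiableOn.div (by fun_prop) (by fun_prop)
    fun z hz => ?_) _
  exact one_sub_star_mul_ne_zero ha (by simpa using (Metric.mem_ball.mp hz).le)

lemma blaschkeFactor_div_sub_one {a z ζ : ℂ} (ha0 : a ≠ 0) (ha : ‖a‖ < 1) (hz : ‖z‖ ≤ 1)
    (hζ : ‖ζ‖ = 1) :
    blaschkeFactor a z / blaschkeFactor a ζ - 1 =
      (z - ζ) * ((1 - ((‖a‖ : ℝ) : ℂ) ^ 2) / ((1 - star a * z) * (ζ - a))) := by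
  have h1 := one_sub_star_mul_ne_zero ha hz
  have h2 := one_sub_star_mul_ne_zero ha hζ.le
  have h3 : star a * a = ((‖a‖ : ℝ) : ℂ) ^ 2 := Complex.conj_mul' a
  have h4 : ζ - a ≠ 0 := by
    rintro h
    rw [sub_eq_zero.mp h] at hζ
    linarith
  have h5 : a - ζ ≠ 0 := by rwa [← neg_sub, neg_ne_zero]
  have h6 : ((‖a‖ : ℝ) : ℂ) ≠ 0 := by simpa using ha0
  rw [← h3]
  unfold blaschkeFactor
  rw [← neg_sub ζ a] at *
  generalize star a = b at *
  have h8 : (‖a‖ : ℂ) / a ≠ 0 := div_ne_zero h6 ha0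
  have h9 : 1 - z * b ≠ 0 := by rwa [mul_comm]
  rw [mul_div_mul_left _ _ h8]
  field_simp
  ring

/-- In a Stolz region with vertex `ζ`, `|1 - conj a * z|` is comparable to its value at `ζ`. -/
lemma norm_one_sub_star_mul_le_of_stolz {a z ζ : ℂ} {M : ℝ} (ha : ‖a‖ ≤ 1) (hz : ‖z‖ < 1)
    (hM : ‖z - ζ‖ ≤ M * (1 - ‖z‖)) :
    ‖1 - star a * ζ‖ ≤ (1 + M) * ‖1 - star a * z‖ := by
  have h1 : ‖1 - star a * ζ‖ ≤ ‖1 - star a * z‖ + ‖z - ζ‖ := by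
    have : 1 - star a * ζ = (1 - star a * z) + star a * (z - ζ) := by ring
    rw [this]
    refine (norm_add_le _ _).trans ?_
    rw [norm_mul, norm_star]
    nlinarith [norm_nonneg (z - ζ)]
  have h2 : 0 ≤ M := by
    by_contra! h
    nlinarith [norm_nonneg (z - ζ)]
  have h3 := one_sub_norm_le_norm_one_sub_star_mul (z := z) ha
  nlinarith

/-! ### Stolz regions and angular limits. -/

lemma div_mem_stolzSet_iff {z ζ : ℂ} (hζ : ‖ζ‖ = 1) {M : ℝ} :
    z / ζ ∈ Complex.stolzSet M ↔ ‖z‖ < 1 ∧ ‖z - ζ‖ < M * (1 - ‖z‖) := by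
  have h0 : ζ ≠ 0 := by
    rintro rfl
    simp at hζ
  have h1 : 1 - z / ζ = (ζ - z) / ζ := by field_simp
  change (‖z / ζ‖ < 1 ∧ ‖1 - z / ζ‖ < M * (1 - ‖z / ζ‖)) ↔ _
  rw [h1, norm_div, norm_div, hζ, div_one, div_one, norm_sub_rev]

lemma HasAngularLimit.of_quotient {f : ℂ → ℂ} {ζ w c : ℂ} (hζ : ‖ζ‖ = 1)
    (h : HasAngularLimit (fun z => (f z - w) / (z - ζ)) ζ c) : HasAngularDerivAt f ζ w c := by
  refine ⟨fun M => ?_, h⟩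
  have h1 : Tendsto (fun z : ℂ => z - ζ) (𝓝[{z : ℂ | z / ζ ∈ Complex.stolzSet M}] ζ) (𝓝 0) :=
    tendsto_nhdsWithin_of_tendsto_nhds (Continuous.tendsto' (by fun_prop) _ _ (sub_self _))
  have h2 := ((h M).mul h1).add_const w
  rw [mul_zero, zero_add] at h2
  refine h2.congr' ?_
  filter_upwards [self_mem_nhdsWithin] with z hz
  have h3 := ((div_mem_stolzSet_iff hζ).mp hz).1
  have h4 : z - ζ ≠ 0 := by
    intro h
    rw [sub_eq_zero.mp h] at h3
    linarith
  rw [div_mul_cancel₀ _ h4, sub_add_cancel]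

/-! ### Frostman's condition and the angular derivative. -/

section Frostman

variable {ι : Type*} {a : ι → ℂ} {ζ : ℂ}

lemma summable_one_sub_norm_div (ha : ∀ i, 0 < ‖a i‖ ∧ ‖a i‖ < 1) (hζ : ‖ζ‖ = 1)
    (hs : Summable fun i => (1 - ‖a i‖ ^ 2) / ‖1 - star (a i) * ζ‖ ^ 2) :
    Summable fun i => 2 * (1 - ‖a i‖) / ‖1 - star (a i) * ζ‖ := by
  -- One factor 2 is in the term, the other comes from `|1 - conj a * ζ| ≤ 2`.
  refine (hs.mul_left 4).of_nonneg_of_le (fun i => ?_) fun i => ?_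
  · have := ha i
    exact div_nonneg (by linarith) (norm_nonneg _)
  · obtain ⟨h0, h1⟩ := ha i
    have h2 : 0 < ‖1 - star (a i) * ζ‖ := norm_pos_iff.mpr (one_sub_star_mul_ne_zero h1 hζ.le)
    have h3 : ‖1 - star (a i) * ζ‖ ≤ 2 := by
      refine (norm_sub_le _ _).trans ?_
      rw [norm_one, norm_mul, norm_star, hζ]
      linarith
    rw [← mul_div_assoc, div_le_div_iff₀ h2 (by positivity)]
    have h4 : 0 < (1 - ‖a i‖) * ‖1 - star (a i) * ζ‖ := mul_pos (by linarith) h2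
    nlinarith [mul_nonneg h4.le h0.le]

lemma multipliable_blaschkeFactor_of_frostman (ha : ∀ i, 0 < ‖a i‖ ∧ ‖a i‖ < 1) (hζ : ‖ζ‖ = 1)
    (hs : Summable fun i => (1 - ‖a i‖ ^ 2) / ‖1 - star (a i) * ζ‖ ^ 2) :
    Multipliable fun i => blaschkeFactor (a i) ζ := by
  have h := multipliable_one_add_of_summable (f := fun i => blaschkeFactor (a i) ζ - 1)
    ((summable_one_sub_norm_div ha hζ hs).of_nonneg_of_le (fun _ => norm_nonneg _) fun i =>
      norm_blaschkeFactor_sub_one_le (norm_pos_iff.mp (ha i).1) (ha i).2 hζ.le)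
  simpa using h

lemma norm_tprod_blaschkeFactor_of_frostman (ha : ∀ i, 0 < ‖a i‖ ∧ ‖a i‖ < 1) (hζ : ‖ζ‖ = 1)
    (hs : Summable fun i => (1 - ‖a i‖ ^ 2) / ‖1 - star (a i) * ζ‖ ^ 2) :
    ‖∏' i, blaschkeFactor (a i) ζ‖ = 1 := by
  rw [(multipliable_blaschkeFactor_of_frostman ha hζ hs).norm_tprod]
  simp [norm_blaschkeFactor_eq_one (norm_pos_iff.mp (ha _).1) (ha _).2 hζ]

/-- Frostman's condition gives a Blaschke product a finite angular derivative. -/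
theorem hasAngularDerivAt_tprod_blaschkeFactor [LinearOrder ι] [LocallyFiniteOrderBot ι]
    (ha : ∀ i, 0 < ‖a i‖ ∧ ‖a i‖ < 1) (hζ : ‖ζ‖ = 1)
    (hs : Summable fun i => (1 - ‖a i‖ ^ 2) / ‖1 - star (a i) * ζ‖ ^ 2) :
    HasAngularDerivAt (fun z => ∏' i, blaschkeFactor (a i) z) ζ (∏' i, blaschkeFactor (a i) ζ)
      ((∏' i, blaschkeFactor (a i) ζ) *
        (((∑' i, (1 - ‖a i‖ ^ 2) / ‖1 - star (a i) * ζ‖ ^ 2 : ℝ) : ℂ) / ζ)) := by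
  refine HasAngularLimit.of_quotient hζ fun M => ?_
  -- Each factor, divided by its value at `ζ`, is `1 + (z - ζ) h i z`, and `h i ζ = v i / ζ`.
  set h : ι → ℂ → ℂ := fun i z =>
    (1 - ((‖a i‖ : ℝ) : ℂ) ^ 2) / ((1 - star (a i) * z) * (ζ - a i)) with hh
  set v : ι → ℝ := fun i => (1 - ‖a i‖ ^ 2) / ‖1 - star (a i) * ζ‖ ^ 2 with hv
  have ha0 : ∀ i, a i ≠ 0 := fun i => norm_pos_iff.mp (ha i).1
  have hζ0 : ζ ≠ 0 := by
    rintro rfl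
    simp at hζ
  have hG : ∀ i z, ‖z‖ ≤ 1 →
      1 + (z - ζ) * h i z = blaschkeFactor (a i) z / blaschkeFactor (a i) ζ := fun i z hz => by
    rw [hh, ← blaschkeFactor_div_sub_one (ha0 i) (ha i).2 hz hζ]
    ring
  have hG1 : ∀ i z, ‖z‖ ≤ 1 → ‖1 + (z - ζ) * h i z‖ ≤ 1 := fun i z hz => by
    rw [hG i z hz, norm_div, norm_blaschkeFactor_eq_one (ha0 i) (ha i).2 hζ, div_one]
    exact norm_blaschkeFactor_le_one (ha0 i) (ha i).2 hz
  have hbound : ∀ i z, ‖z‖ < 1 → ‖z - ζ‖ ≤ M * (1 - ‖z‖) → ‖h i z‖ ≤ (1 + M) * v i := by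
    intro i z hz hM
    have h1 : 0 < ‖1 - star (a i) * ζ‖ :=
      norm_pos_iff.mpr (one_sub_star_mul_ne_zero (ha i).2 hζ.le)
    have h2 : 0 < ‖1 - star (a i) * z‖ :=
      norm_pos_iff.mpr (one_sub_star_mul_ne_zero (ha i).2 hz.le)
    have h3 := norm_one_sub_star_mul_le_of_stolz (ha i).2.le hz hM
    have h4 : 0 ≤ 1 - ‖a i‖ ^ 2 := by
      have := pow_le_one₀ (n := 2) (norm_nonneg _) (ha i).2.le
      linarith
    have h5 : ‖1 - ((‖a i‖ : ℝ) : ℂ) ^ 2‖ = 1 - ‖a i‖ ^ 2 := by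
      rw [← Complex.ofReal_one, ← Complex.ofReal_pow, ← Complex.ofReal_sub, Complex.norm_real,
        Real.norm_of_nonneg h4]
    rw [hh, hv]
    simp only
    rw [norm_div, norm_mul, h5, ← norm_one_sub_star_mul_eq hζ, ← mul_div_assoc,
      div_le_div_iff₀ (by positivity) (by positivity)]
    calc (1 - ‖a i‖ ^ 2) * ‖1 - star (a i) * ζ‖ ^ 2
        = (1 - ‖a i‖ ^ 2) * ‖1 - star (a i) * ζ‖ * ‖1 - star (a i) * ζ‖ := by ring
      _ ≤ (1 - ‖a i‖ ^ 2) * ‖1 - star (a i) * ζ‖ * ((1 + M) * ‖1 - star (a i) * z‖) := by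
          gcongr
      _ = _ := by ring
  -- The partial products cost nothing: each factor has modulus at most 1 at `z` and exactly 1 at
  -- `ζ`. Hence `(1 + M) v i` dominates the telescoping terms.
  have hP : ∀ i z, ‖z‖ ≤ 1 → ‖∏ j ∈ Finset.Iio i, (1 + (z - ζ) * h j z)‖ ≤ 1 := fun i z hz => by
    rw [norm_prod]
    exact Finset.prod_le_one (fun _ _ => norm_nonneg _) fun j _ => hG1 j z hz
  have hterm : ∀ i z, ‖z‖ < 1 → ‖z - ζ‖ ≤ M * (1 - ‖z‖) →
      ‖h i z * ∏ j ∈ Finset.Iio i, (1 + (z - ζ) * h j z)‖ ≤ (1 + M) * v i := by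
    intro i z hz hM
    rw [norm_mul]
    exact (mul_le_of_le_one_right (norm_nonneg _) (hP i z hz.le)).trans (hbound i z hz hM)
  have hmem : ∀ᶠ z in 𝓝[{z : ℂ | z / ζ ∈ Complex.stolzSet M}] ζ,
      ‖z‖ < 1 ∧ ‖z - ζ‖ ≤ M * (1 - ‖z‖) := by
    filter_upwards [self_mem_nhdsWithin] with z hz
    have := (div_mem_stolzSet_iff hζ).mp hz
    exact ⟨this.1, this.2.le⟩
  have hhcont : ∀ i, ContinuousAt (h i) ζ := fun i => by
    have h1 := one_sub_star_mul_ne_zero (ha i).2 hζ.le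
    have h2 : ζ - a i ≠ 0 := by
      rw [← norm_ne_zero_iff, ← norm_one_sub_star_mul_eq hζ]
      exact norm_ne_zero_iff.mpr h1
    exact ContinuousAt.div (by fun_prop) (by fun_prop) (mul_ne_zero h1 h2)
  have hlim : Tendsto (fun z => ∑' i, h i z * ∏ j ∈ Finset.Iio i, (1 + (z - ζ) * h j z))
      (𝓝[{z : ℂ | z / ζ ∈ Complex.stolzSet M}] ζ) (𝓝 (∑' i, h i ζ)) := by
    refine tendsto_tsum_of_dominated_convergence (hs.mul_left (1 + M)) (fun i => ?_) ?_
    · have hc : ContinuousAt (fun z => h i z * ∏ j ∈ Finset.Iio i, (1 + (z - ζ) * h j z)) ζ := by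
        fun_prop
      have := hc.tendsto
      simp only [sub_self, zero_mul, add_zero, Finset.prod_const_one, mul_one] at this
      exact this.mono_left nhdsWithin_le_nhds
    · filter_upwards [hmem] with z hz i using hterm i z hz.1 hz.2
  have hsum : ∑' i, h i ζ = ((∑' i, v i : ℝ) : ℂ) / ζ := by
    rw [Complex.ofReal_tsum, ← tsum_div_const]
    refine tsum_congr fun i => ?_
    have h1 := one_sub_star_mul_ne_zero (ha i).2 hζ.le
    have h2 : ζ - a i ≠ 0 := by
      rw [← norm_ne_zero_iff, ← norm_one_sub_star_mul_eq hζ]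
      exact norm_ne_zero_iff.mpr h1
    have h3 : ((‖1 - star (a i) * ζ‖ : ℝ) : ℂ) ^ 2 * ζ = (1 - star (a i) * ζ) * (ζ - a i) := by
      rw [norm_one_sub_star_mul_eq hζ]
      have h4 : star (ζ - a i) * (ζ - a i) = ((‖ζ - a i‖ : ℝ) : ℂ) ^ 2 := Complex.conj_mul' _
      have h5 : star ζ * ζ = 1 := by
        have := Complex.conj_mul' ζ
        rw [hζ] at this
        simpa using this
      rw [← h4, star_sub]
      linear_combination (ζ - a i) * h5
    simp only [hh, hv]
    push_cast
    rw [div_div, h3]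
  rw [← hsum]
  refine (hlim.const_mul (∏' i, blaschkeFactor (a i) ζ)).congr' ?_
  filter_upwards [hmem] with z ⟨hz, hM⟩
  have hne : z - ζ ≠ 0 := by
    intro h
    rw [sub_eq_zero.mp h] at hz
    linarith
  have hmul : Multipliable fun i => 1 + (z - ζ) * h i z := by
    refine multipliable_one_add_of_summable ?_
    refine ((hs.mul_left (1 + M)).mul_left ‖z - ζ‖).of_nonneg_of_le (fun _ => norm_nonneg _)
      fun i => ?_
    rw [norm_mul]
    exact mul_le_mul_of_nonneg_left (hbound i z hz hM) (norm_nonneg _)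
  have hsm : Summable fun i => h i z * ∏ j ∈ Finset.Iio i, (1 + (z - ζ) * h j z) :=
    (hs.mul_left (1 + M)).of_norm_bounded fun i => hterm i z hz hM
  -- Telescoping: `∏ (1 + x_i) = 1 + ∑ x_i ∏_{j < i} (1 + x_j)`. The order on `ι` serves only this
  -- expansion.
  have hexp := tprod_one_add_ordered (f := fun i => (z - ζ) * h i z)
    (by simpa only [mul_assoc] using hsm.mul_left (z - ζ)) hmul
  simp only [mul_assoc] at hexp
  rw [tsum_mul_left] at hexp
  have hprod : ∏' i, blaschkeFactor (a i) z =
      (∏' i, blaschkeFactor (a i) ζ) * ∏' i, (1 + (z - ζ) * h i z) := by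
    rw [← (multipliable_blaschkeFactor_of_frostman ha hζ hs).tprod_mul hmul]
    refine tprod_congr fun i => ?_
    rw [hG i z hz.le, mul_div_cancel₀]
    rw [← norm_ne_zero_iff, norm_blaschkeFactor_eq_one (ha0 i) (ha i).2 hζ]
    exact one_ne_zero
  rw [hprod, hexp]
  field_simp
  ring

end Frostman

/-! ### From angular derivatives to radial limits and phase derivatives. -/

lemma HasAngularLimit.hasRadialLimit {f : ℂ → ℂ} {ζ w : ℂ} (hζ : ‖ζ‖ = 1)
    (h : HasAngularLimit f ζ w) : HasRadialLimit f ζ w := by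
  have hζ0 : ζ ≠ 0 := by
    rintro rfl
    simp at hζ
  refine (h 2).comp (tendsto_nhdsWithin_iff.mpr ⟨?_, ?_⟩)
  · refine tendsto_nhdsWithin_of_tendsto_nhds (Continuous.tendsto' (by fun_prop) _ _ ?_)
    simp
  · filter_upwards [Ioo_mem_nhdsLT (zero_lt_one (α := ℝ))] with r hr
    rw [mul_div_cancel_right₀ _ hζ0]
    have h1 : ‖(r : ℂ)‖ = r := by rw [Complex.norm_real, Real.norm_of_nonneg hr.1.le]
    have h2 : ‖1 - (r : ℂ)‖ = 1 - r := by
      rw [← Complex.ofReal_one, ← Complex.ofReal_sub, Complex.norm_real,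
        Real.norm_of_nonneg (by linarith [hr.2])]
    change ‖(r : ℂ)‖ < 1 ∧ ‖1 - (r : ℂ)‖ < 2 * (1 - ‖(r : ℂ)‖)
    rw [h1, h2]
    exact ⟨hr.2, by linarith [hr.2]⟩

/-- The derivative of a function with an angular derivative tends to it along the radius. -/
lemma HasAngularDerivAt.tendsto_deriv {f : ℂ → ℂ} {ζ w c : ℂ} (hζ : ‖ζ‖ = 1)
    (hf : DifferentiableOn ℂ f (Metric.ball 0 1)) (h : HasAngularDerivAt f ζ w c) :
    Tendsto (fun r : ℝ => deriv f (r * ζ)) (𝓝[<] 1) (𝓝 c) := by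
  have hζ0 : ζ ≠ 0 := by
    rintro rfl
    simp at hζ
  rw [Metric.tendsto_nhds]
  intro ε hε
  -- On the disk of radius `R = (1 - r) / 2` about `r ζ`, `|z - ζ| ≤ 3R ≤ 3 (1 - |z|)`, so aperture
  -- 4 contains it. Cauchy's estimate then yields `3ε / 4 < ε`.
  have h1 := Metric.tendsto_nhds.mp (h.2 4) (ε / 4) (by positivity)
  rw [eventually_nhdsWithin_iff, Metric.eventually_nhds_iff] at h1
  obtain ⟨δ, hδ, h1⟩ := h1
  filter_upwards [Ioo_mem_nhdsLT (zero_lt_one (α := ℝ)),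
    Ioo_mem_nhdsLT (show 1 - δ / 2 < 1 by linarith)] with r hr hr'
  set z₀ : ℂ := r * ζ with hz₀
  have hn0 : ‖z₀‖ = r := by
    rw [hz₀, norm_mul, hζ, mul_one, Complex.norm_real, Real.norm_of_nonneg hr.1.le]
  have hd0 : ‖z₀ - ζ‖ = 1 - r := by
    have : z₀ - ζ = -(((1 - r : ℝ) : ℂ) * ζ) := by rw [hz₀]; push_cast; ring
    rw [this, norm_neg, norm_mul, hζ, mul_one, Complex.norm_real,
      Real.norm_of_nonneg (by linarith [hr.2])]
  set R : ℝ := (1 - r) / 2 with hR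
  have hRpos : 0 < R := by rw [hR]; linarith [hr.2]
  have hnear : ∀ z ∈ Metric.closedBall z₀ R, ‖z‖ < 1 ∧ ‖z - ζ‖ ≤ 3 * R ∧ R ≤ 1 - ‖z‖ := by
    intro z hz
    have h2 : ‖z - z₀‖ ≤ R := by simpa [dist_eq_norm] using hz
    have h3 : ‖z‖ ≤ ‖z₀‖ + ‖z - z₀‖ := by simpa using norm_add_le z₀ (z - z₀)
    have h4 : ‖z - ζ‖ ≤ ‖z - z₀‖ + ‖z₀ - ζ‖ := norm_sub_le_norm_sub_add_norm_sub _ _ _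
    refine ⟨?_, ?_, ?_⟩ <;> linarith
  set g : ℂ → ℂ := fun z => f z - w - c * (z - ζ) with hg
  have hball : Metric.closedBall z₀ R ⊆ Metric.ball 0 1 := fun z hz => by
    simpa using (hnear z hz).1
  have hfd : ∀ z ∈ Metric.closedBall z₀ R, DifferentiableAt ℂ f z := fun z hz =>
    hf.differentiableAt (Metric.isOpen_ball.mem_nhds (hball hz))
  have hgd : ∀ z ∈ Metric.closedBall z₀ R, DifferentiableAt ℂ g z := fun z hz => by
    have := hfd z hz
    fun_prop
  have hgb : ∀ z ∈ Metric.sphere z₀ R, ‖g z‖ ≤ ε / 4 * (3 * R) := by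
    intro z hz
    obtain ⟨h2, h3, h4⟩ := hnear z (Metric.sphere_subset_closedBall hz)
    have h5 : z - ζ ≠ 0 := by
      intro h
      rw [sub_eq_zero.mp h] at h2
      linarith
    have h6 := h1 (y := z) (by rw [dist_eq_norm]; linarith [hr'.1]) (by
      have h0 : 1 - z / ζ = (ζ - z) / ζ := by field_simp
      change ‖z / ζ‖ < 1 ∧ ‖1 - z / ζ‖ < 4 * (1 - ‖z / ζ‖)
      rw [h0, norm_div, norm_div, hζ, div_one, div_one, norm_sub_rev]
      exact ⟨h2, by linarith⟩)
    have h7 : g z = ((f z - w) / (z - ζ) - c) * (z - ζ) := by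
      rw [hg, sub_mul, div_mul_cancel₀ _ h5]
    rw [h7, norm_mul]
    rw [dist_eq_norm] at h6
    exact mul_le_mul h6.le h3 (norm_nonneg _) (by positivity)
  have hderiv := Complex.norm_deriv_le_of_forall_mem_sphere_norm_le hRpos
    (DifferentiableOn.diffContOnCl (f := g) (s := Metric.ball z₀ R) (by
      rw [closure_ball _ hRpos.ne']
      exact fun z hz => (hgd z hz).differentiableWithinAt)) hgb
  have hd : deriv g z₀ = deriv f z₀ - c := by
    have h2 := (hfd z₀ (Metric.mem_closedBall_self hRpos.le)).hasDerivAt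
    have h3 := (h2.sub_const w).sub (((hasDerivAt_id z₀).sub_const ζ).const_mul c)
    simpa using! h3.deriv
  rw [hd] at hderiv
  rw [dist_eq_norm]
  refine hderiv.trans_lt ?_
  rw [div_lt_iff₀ hRpos]
  nlinarith

/-- On the circle of radius `r` the phase has derivative `Re (z f'(z) / f(z))`, and both `f` and
`f'` converge along the radius. -/
theorem HasAngularDerivAt.hasPhaseDerivAt {f : ℂ → ℂ} {w c : ℂ} {t : ℝ}
    (hf : DifferentiableOn ℂ f (Metric.ball 0 1)) (hw : w ≠ 0)
    (h : HasAngularDerivAt f (Complex.exp (Complex.I * t)) w c) :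
    HasPhaseDerivAt f t (Complex.exp (Complex.I * t) * c / w).re := by
  set ζ := Complex.exp (Complex.I * t) with hζdef
  have hζ : ‖ζ‖ = 1 := by rw [hζdef, mul_comm, Complex.norm_exp_ofReal_mul_I]
  have hlim : Tendsto (fun r : ℝ => f (r * ζ)) (𝓝[<] 1) (𝓝 w) := h.1.hasRadialLimit hζ
  refine ⟨fun r => ((r : ℂ) * ζ * deriv f (r * ζ) / f (r * ζ)).re, ?_, ?_⟩
  · filter_upwards [Ioo_mem_nhdsLT (zero_lt_one (α := ℝ)), hlim.eventually_ne hw] with r hr hne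
    -- Normalised so that `u t = 1`, which keeps the principal logarithm away from its cut.
    set u : ℝ → ℂ := fun s => f (r * Complex.exp (Complex.I * s)) / f (r * ζ) with hu
    have hin : (r : ℂ) * ζ ∈ Metric.ball (0 : ℂ) 1 := by
      rw [mem_ball_zero_iff, norm_mul, hζ, mul_one, Complex.norm_real,
        Real.norm_of_nonneg hr.1.le]
      exact hr.2
    have hfd := (hf.differentiableAt (Metric.isOpen_ball.mem_nhds hin)).hasDerivAt
    have hcirc : HasDerivAt (fun s : ℝ => (r : ℂ) * Complex.exp (Complex.I * s))
        (r * (ζ * Complex.I)) t := by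
      have h1 : HasDerivAt (fun s : ℝ => Complex.I * (s : ℂ)) (Complex.I * 1) t :=
        (Complex.ofRealCLM.hasDerivAt (x := t)).const_mul Complex.I
      rw [mul_one] at h1
      exact h1.cexp.const_mul _
    have hud : HasDerivAt u (deriv f (r * ζ) * (r * (ζ * Complex.I)) / f (r * ζ)) t :=
      (HasDerivAt.comp t hfd hcirc).div_const _
    have hut : u t = 1 := div_self hne
    have hslit : u t ∈ Complex.slitPlane := by rw [hut]; exact Complex.one_mem_slitPlane
    refine ⟨fun s => (Complex.log (u s)).im + Complex.arg (f (r * ζ)), ?_, ?_⟩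
    · filter_upwards [hud.continuousAt.eventually_ne (show u t ≠ 0 by rw [hut]; exact one_ne_zero)]
        with s hs
      have hs0 : f (r * Complex.exp (Complex.I * s)) ≠ 0 := by
        intro h0
        exact hs (by simp only [hu, h0, zero_div])
      refine ⟨hs0, ?_⟩
      have h1 : f (r * Complex.exp (Complex.I * s)) = u s * f (r * ζ) :=
        (div_mul_cancel₀ _ hne).symm
      rw [h1, norm_mul, Complex.log_im]
      conv_lhs => rw [← Complex.norm_mul_exp_arg_mul_I (u s),
        ← Complex.norm_mul_exp_arg_mul_I (f (r * ζ))]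
      push_cast
      rw [mul_add, Complex.exp_add, mul_comm Complex.I, mul_comm Complex.I]
      ring
    · have h1 := hud.clog_real hslit
      rw [hut, div_one] at h1
      have h2 := (Complex.imCLM.hasFDerivAt.comp_hasDerivAt t h1).add_const
        (Complex.arg (f (r * ζ)))
      convert! h2 using 1
      have h3 : deriv f (r * ζ) * (r * (ζ * Complex.I)) / f (r * ζ) =
          (r * ζ * deriv f (r * ζ) / f (r * ζ)) * Complex.I := by ring
      rw [h3]
      simp
  · have h1 : Tendsto (fun r : ℝ => (r : ℂ) * ζ) (𝓝[<] 1) (𝓝 ζ) :=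
      tendsto_nhdsWithin_of_tendsto_nhds (Continuous.tendsto' (by fun_prop) _ _ (by simp))
    exact (Complex.continuous_re.tendsto _).comp
      ((h1.mul (h.tendsto_deriv hζ hf)).div hlim hw)

/-! ### The zeros `a_n` and their distance to the circle points. -/

lemma norm_zeroSeq (n : ℕ+) : ‖zeroSeq n‖ = 1 - (1 / 16 : ℝ) ^ (n : ℕ) := by
  have h1 : (1 - 1 / 2 ^ (4 * (n : ℕ)) : ℂ) = ((1 - (1 / 16 : ℝ) ^ (n : ℕ) : ℝ) : ℂ) := by
    rw [pow_mul]
    push_cast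
    rw [one_div_pow]
    norm_num
  have h2 : (Complex.I * (1 / 2 ^ (n : ℕ)) : ℂ) = ((1 / 2 ^ (n : ℕ) : ℝ) : ℂ) * Complex.I := by
    push_cast
    ring
  rw [zeroSeq, h1, h2, norm_mul, Complex.norm_exp_ofReal_mul_I, mul_one, Complex.norm_real,
    Real.norm_of_nonneg]
  have := pow_le_one₀ (n := (n : ℕ)) (show (0 : ℝ) ≤ 1 / 16 by norm_num) (by norm_num)
  linarith

lemma one_div_sixteen_pow_le (n : ℕ+) : (1 / 16 : ℝ) ^ (n : ℕ) ≤ 1 / 16 :=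
  pow_le_of_le_one (by norm_num) (by norm_num) n.ne_zero

lemma norm_zeroSeq_pos_lt_one (n : ℕ+) : 0 < ‖zeroSeq n‖ ∧ ‖zeroSeq n‖ < 1 := by
  rw [norm_zeroSeq]
  have h1 := one_div_sixteen_pow_le n
  have h2 : (0 : ℝ) < (1 / 16 : ℝ) ^ (n : ℕ) := by positivity
  constructor <;> linarith

lemma summable_pow_pnat {r : ℝ} (h0 : 0 ≤ r) (h1 : r < 1) :
    Summable fun n : ℕ+ => r ^ (n : ℕ) :=
  (summable_geometric_of_lt_one h0 h1).comp_injective PNat.coe_injective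

lemma summable_one_sub_norm_zeroSeq : Summable fun n : ℕ+ => 1 - ‖zeroSeq n‖ := by
  simp only [norm_zeroSeq, sub_sub_cancel]
  exact summable_pow_pnat (by norm_num) (by norm_num)

lemma tendsto_zeroSeq : Tendsto zeroSeq cofinite (𝓝 1) := by
  have hval : Tendsto (fun n : ℕ+ => (n : ℕ)) cofinite atTop :=
    Nat.cofinite_eq_atTop ▸ PNat.coe_injective.tendsto_cofinite
  have h1 : Tendsto (fun n : ℕ => (1 / 16 : ℂ) ^ n) atTop (𝓝 0) :=
    tendsto_pow_atTop_nhds_zero_of_norm_lt_one (by norm_num)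
  have h2 : Tendsto (fun n : ℕ => (1 / 2 : ℂ) ^ n) atTop (𝓝 0) :=
    tendsto_pow_atTop_nhds_zero_of_norm_lt_one (by norm_num)
  have h3 : Tendsto (fun n : ℕ => (1 - (1 / 16 : ℂ) ^ n) * Complex.exp (Complex.I * (1 / 2) ^ n))
      atTop (𝓝 1) := by
    have := (h1.const_sub 1).mul ((Complex.continuous_exp.tendsto _).comp (h2.const_mul Complex.I))
    simpa using this
  refine (h3.comp hval).congr fun n => ?_
  simp only [Function.comp_apply, zeroSeq, pow_mul, one_div, inv_pow]
  norm_num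

/-- At `ζ = 1` the imaginary part `|a_n| sin 2⁻ⁿ` already gives the bound. Elsewhere the distance
stays bounded below, since `a_n → 1`. -/
lemma exists_le_norm_sub_zeroSeq (ζ : ℂ) :
    ∃ c > 0, ∀ᶠ n : ℕ+ in cofinite, c * (1 / 2 : ℝ) ^ (n : ℕ) ≤ ‖ζ - zeroSeq n‖ := by
  by_cases hζ : ζ = 1
  -- `sin x ≥ x / 2` and `|a_n| ≥ 15/16` give `15/32 > 1/4`.
  · refine ⟨1 / 4, by norm_num, .of_forall fun n => ?_⟩
    set x : ℝ := (1 / 2 : ℝ) ^ (n : ℕ) with hx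
    have hx0 : 0 < x := by positivity
    have hx1 : x ≤ 1 := pow_le_one₀ (by norm_num) (by norm_num)
    have h1 : zeroSeq n = ((1 - (1 / 16 : ℝ) ^ (n : ℕ) : ℝ) : ℂ) *
        Complex.exp ((x : ℂ) * Complex.I) := by
      rw [zeroSeq, pow_mul, hx]
      push_cast
      rw [mul_comm Complex.I, one_div_pow, one_div_pow]
      norm_num
    have h2 : (zeroSeq n).im = (1 - (1 / 16 : ℝ) ^ (n : ℕ)) * Real.sin x := by
      rw [h1, Complex.im_ofReal_mul, Complex.exp_ofReal_mul_I_im]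
    have h3 := Real.sin_gt_sub_cube hx0
    have h4 := one_div_sixteen_pow_le n
    have h5 : 1 / 2 * x ≤ Real.sin x := by nlinarith [pow_le_of_le_one hx0.le hx1 three_ne_zero]
    have h6 := Complex.abs_im_le_norm (ζ - zeroSeq n)
    rw [hζ, Complex.sub_im, Complex.one_im, zero_sub, abs_neg, h2] at h6
    rw [hζ]
    refine le_trans ?_ ((le_abs_self _).trans h6)
    nlinarith
  · have hpos : 0 < ‖ζ - 1‖ := norm_pos_iff.mpr (sub_ne_zero.mpr hζ)
    refine ⟨‖ζ - 1‖ / 2, by positivity, ?_⟩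
    have h1 := (tendsto_zeroSeq.const_sub ζ).norm.eventually_const_le (half_lt_self hpos)
    filter_upwards [h1] with n hn
    exact (mul_le_of_le_one_right (by positivity)
      (pow_le_one₀ (by norm_num) (by norm_num))).trans hn

/-- The zeros satisfy Frostman's condition at every point of the unit circle. -/
lemma summable_frostman_zeroSeq {ζ : ℂ} (hζ : ‖ζ‖ = 1) :
    Summable fun n : ℕ+ => (1 - ‖zeroSeq n‖ ^ 2) / ‖1 - star (zeroSeq n) * ζ‖ ^ 2 := by
  obtain ⟨c, hc, h⟩ := exists_le_norm_sub_zeroSeq ζ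
  refine ((summable_pow_pnat (r := 1 / 4) (by norm_num) (by norm_num)).mul_left
    (2 / c ^ 2)).of_norm_bounded_eventually ?_
  filter_upwards [h] with n hn
  obtain ⟨h0, h1⟩ := norm_zeroSeq_pos_lt_one n
  have h2 : 0 ≤ 1 - ‖zeroSeq n‖ ^ 2 := by nlinarith
  have h3 : 1 - ‖zeroSeq n‖ ^ 2 ≤ 2 * (1 / 16 : ℝ) ^ (n : ℕ) := by
    have := norm_zeroSeq n
    nlinarith
  rw [Real.norm_of_nonneg (by positivity), norm_one_sub_star_mul_eq hζ]
  calc (1 - ‖zeroSeq n‖ ^ 2) / ‖ζ - zeroSeq n‖ ^ 2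
      ≤ 2 * (1 / 16 : ℝ) ^ (n : ℕ) / (c * (1 / 2 : ℝ) ^ (n : ℕ)) ^ 2 := by gcongr
    _ = 2 / c ^ 2 * (1 / 4) ^ (n : ℕ) := by
      have h4 : (1 / 16 : ℝ) ^ (n : ℕ) = ((1 / 2 : ℝ) ^ (n : ℕ)) ^ 4 := by
        rw [← pow_mul, mul_comm (n : ℕ) 4, pow_mul]
        norm_num
      have h5 : (1 / 4 : ℝ) ^ (n : ℕ) = ((1 / 2 : ℝ) ^ (n : ℕ)) ^ 2 := by
        rw [← pow_mul, mul_comm (n : ℕ) 2, pow_mul]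
        norm_num
      have h6 : (0 : ℝ) < (1 / 2 : ℝ) ^ (n : ℕ) := by positivity
      rw [h4, h5]
      field_simp

/-! ### Convergence and analyticity in the disk. -/

lemma multipliableLocallyUniformlyOn_blaschkeFactor {ι : Type*} {a : ι → ℂ}
    (ha : ∀ i, 0 < ‖a i‖ ∧ ‖a i‖ < 1) (hs : Summable fun i => 1 - ‖a i‖) :
    MultipliableLocallyUniformlyOn (fun i z => blaschkeFactor (a i) z) (Metric.ball 0 1) := by
  refine ⟨fun z => ∏' i, blaschkeFactor (a i) z,
    hasProdLocallyUniformlyOn_of_forall_compact Metric.isOpen_ball fun K hK hKc => ?_⟩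
  obtain ⟨r, hr, hKr⟩ : ∃ r < 1, K ⊆ Metric.closedBall (0 : ℂ) r := by
    obtain ⟨r, hr, h⟩ := exists_lt_subset_ball hKc.isClosed hK
    exact ⟨r, hr, h.trans Metric.ball_subset_closedBall⟩
  have h := Summable.hasProdUniformlyOn_one_add (f := fun i z => blaschkeFactor (a i) z - 1) hKc
    (hs.mul_left (2 / (1 - r))) (.of_forall fun i z hz => ?_) fun i => ?_
  · simpa using h
  · have hz' : ‖z‖ ≤ r := by simpa using hKr hz
    refine (norm_blaschkeFactor_sub_one_le (norm_pos_iff.mp (ha i).1) (ha i).2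
      (hz'.trans hr.le)).trans ?_
    have h1 := one_sub_norm_le_norm_one_sub_star_mul (z := z) (ha i).2.le
    have h2 : 0 < 1 - r := by linarith
    have h3 : 0 ≤ 1 - ‖a i‖ := by linarith [(ha i).2]
    rw [div_mul_eq_mul_div]
    gcongr
    linarith
  · exact ((continuousOn_blaschkeFactor (ha i).2).mono
      (hK.trans Metric.ball_subset_closedBall)).sub continuousOn_const

lemma differentiableOn_tprod_blaschkeFactor {ι : Type*} {a : ι → ℂ}
    (ha : ∀ i, 0 < ‖a i‖ ∧ ‖a i‖ < 1) (hs : Summable fun i => 1 - ‖a i‖) :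
    DifferentiableOn ℂ (fun z => ∏' i, blaschkeFactor (a i) z) (Metric.ball 0 1) :=
  (multipliableLocallyUniformlyOn_blaschkeFactor ha hs).hasProdLocallyUniformlyOn.differentiableOn
    (.of_forall fun _ => by
      simpa [Finset.prod_fn] using DifferentiableOn.finsetProd fun i _ =>
        differentiableOn_blaschkeFactor (ha i).2) Metric.isOpen_ball

lemma norm_tprod_blaschkeFactor_le_one {ι : Type*} {a : ι → ℂ} {z : ℂ}
    (ha : ∀ i, 0 < ‖a i‖ ∧ ‖a i‖ < 1) (hs : Summable fun i => 1 - ‖a i‖) (hz : ‖z‖ < 1) :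
    ‖∏' i, blaschkeFactor (a i) z‖ ≤ 1 := by
  have h := ((multipliableLocallyUniformlyOn_blaschkeFactor ha hs).multipliable
    (mem_ball_zero_iff.mpr hz)).hasProd.norm
  refine le_of_tendsto' h fun s => Finset.prod_le_one (fun _ _ => norm_nonneg _) fun i _ => ?_
  exact norm_blaschkeFactor_le_one (norm_pos_iff.mp (ha i).1) (ha i).2 hz.le

/-! ### Boundary behaviour of `B₁` and its subproducts. -/

lemma differentiableOn_blaschkeB₁ : DifferentiableOn ℂ blaschkeB₁ (Metric.ball 0 1) :=
  differentiableOn_id.mul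
    (differentiableOn_tprod_blaschkeFactor norm_zeroSeq_pos_lt_one summable_one_sub_norm_zeroSeq)

lemma norm_blaschkeB₁_lt_one {z : ℂ} (hz : ‖z‖ < 1) : ‖blaschkeB₁ z‖ < 1 := by
  rw [blaschkeB₁, norm_mul]
  exact (mul_le_of_le_one_right (norm_nonneg _) (norm_tprod_blaschkeFactor_le_one
    norm_zeroSeq_pos_lt_one summable_one_sub_norm_zeroSeq hz)).trans_lt hz

theorem exists_hasAngularDerivAt_blaschkeB₁ {ζ : ℂ} (hζ : ‖ζ‖ = 1) :
    ∃ w c : ℂ, HasAngularDerivAt blaschkeB₁ ζ w c ∧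
      ‖w‖ = 1 ∧ ∃ x : ℝ, ζ * c / w = (x : ℂ) ∧ 1 < x := by
  have hs := summable_frostman_zeroSeq hζ
  have hb := hasAngularDerivAt_tprod_blaschkeFactor norm_zeroSeq_pos_lt_one hζ hs
  have hw := norm_tprod_blaschkeFactor_of_frostman norm_zeroSeq_pos_lt_one hζ hs
  set b : ℂ → ℂ := fun z => ∏' n : ℕ+, blaschkeFactor (zeroSeq n) z with hbdef
  set σ : ℝ := ∑' n : ℕ+, (1 - ‖zeroSeq n‖ ^ 2) / ‖1 - star (zeroSeq n) * ζ‖ ^ 2 with hσ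
  change HasAngularDerivAt b ζ (b ζ) (b ζ * (σ / ζ)) at hb
  change ‖b ζ‖ = 1 at hw
  have hζ0 : ζ ≠ 0 := by
    rintro rfl
    simp at hζ
  have hb0 : b ζ ≠ 0 := by
    rw [← norm_ne_zero_iff, hw]
    exact one_ne_zero
  refine ⟨ζ * b ζ, b ζ + ζ * (b ζ * (σ / ζ)), ?_, by rw [norm_mul, hζ, hw, one_mul],
    1 + σ, ?_, ?_⟩
  · refine HasAngularLimit.of_quotient hζ fun M => ?_
    refine ((hb.1 M).add ((hb.2 M).const_mul ζ)).congr' ?_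
    filter_upwards [self_mem_nhdsWithin] with z hz
    have h3 := ((div_mem_stolzSet_iff hζ).mp hz).1
    have h4 : z - ζ ≠ 0 := by
      intro h
      rw [sub_eq_zero.mp h] at h3
      linarith
    change _ = (z * b z - ζ * b ζ) / (z - ζ)
    field_simp
    ring
  · push_cast
    field_simp
  · have hterm : ∀ n : ℕ+, 0 < (1 - ‖zeroSeq n‖ ^ 2) / ‖1 - star (zeroSeq n) * ζ‖ ^ 2 := by
      intro n
      obtain ⟨h0, h1⟩ := norm_zeroSeq_pos_lt_one n
      have h2 : 0 < ‖1 - star (zeroSeq n) * ζ‖ :=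
        norm_pos_iff.mpr (one_sub_star_mul_ne_zero h1 hζ.le)
      have h3 : 0 < 1 - ‖zeroSeq n‖ ^ 2 := by nlinarith
      positivity
    have : 0 < σ := hs.tsum_pos (fun n => (hterm n).le) 1 (hterm 1)
    linarith

theorem exists_hasRadialLimit_subproductB₁ (k : Fin 2) (S : Set ℕ+) {ζ : ℂ} (hζ : ‖ζ‖ = 1) :
    ∃ w : ℂ, ‖w‖ = 1 ∧ HasRadialLimit (subproductB₁ k S) ζ w := by
  classical
  have ha : ∀ n : S, 0 < ‖zeroSeq n‖ ∧ ‖zeroSeq n‖ < 1 := fun n => norm_zeroSeq_pos_lt_one n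
  have hs := (summable_frostman_zeroSeq hζ).subtype S
  have hb := (hasAngularDerivAt_tprod_blaschkeFactor ha hζ hs).1.hasRadialLimit hζ
  refine ⟨ζ ^ (k : ℕ) * ∏' n : S, blaschkeFactor (zeroSeq n) ζ, ?_, ?_⟩
  · rw [norm_mul, norm_pow, hζ, one_pow, one_mul]
    exact norm_tprod_blaschkeFactor_of_frostman ha hζ hs
  · have h1 : Tendsto (fun r : ℝ => ((r : ℂ) * ζ) ^ (k : ℕ)) (𝓝[<] 1) (𝓝 (ζ ^ (k : ℕ))) :=
      tendsto_nhdsWithin_of_tendsto_nhds (Continuous.tendsto' (by fun_prop) _ _ (by simp))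
    exact h1.mul hb

/-! ### The function `z / (1 - B₁)²` and the class `𝒰`. -/

lemma Finset.one_sub_sum_le_prod_one_sub {ι : Type*} (s : Finset ι) {x : ι → ℝ}
    (h0 : ∀ i, 0 ≤ x i) (h1 : ∀ i, x i ≤ 1) : 1 - ∑ i ∈ s, x i ≤ ∏ i ∈ s, (1 - x i) := by
  classical
  induction s using Finset.induction_on with
  | empty => simp
  | insert i s hi ih =>
    rw [Finset.sum_insert hi, Finset.prod_insert hi]
    have h2 : ∏ j ∈ s, (1 - x j) ≤ 1 :=
      Finset.prod_le_one (fun j _ => by linarith [h1 j]) fun j _ => by linarith [h0 j]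
    nlinarith [h0 i]

/-- The modulus is `∏ (1 - 16⁻ⁿ) ≥ 1 - ∑ 16⁻ⁿ`. -/
lemma le_norm_tprod_blaschkeFactor_zero :
    14 / 15 ≤ ‖∏' n : ℕ+, blaschkeFactor (zeroSeq n) 0‖ := by
  have h := ((multipliableLocallyUniformlyOn_blaschkeFactor norm_zeroSeq_pos_lt_one
    summable_one_sub_norm_zeroSeq).multipliable (Metric.mem_ball_self one_pos)).hasProd.norm
  have hsum : ∑' n : ℕ+, (1 / 16 : ℝ) ^ (n : ℕ) = 1 / 15 := by
    rw [tsum_pnat_eq_tsum_succ (f := fun n : ℕ => (1 / 16 : ℝ) ^ n)]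
    simp only [pow_succ]
    rw [tsum_mul_right, tsum_geometric_of_lt_one (by norm_num) (by norm_num)]
    norm_num
  refine ge_of_tendsto' h fun s => ?_
  have hf : ∀ n : ℕ+, ‖blaschkeFactor (zeroSeq n) 0‖ = 1 - (1 / 16 : ℝ) ^ (n : ℕ) := fun n => by
    rw [blaschkeFactor, norm_mul,
      norm_ofReal_norm_div_self (norm_pos_iff.mp (norm_zeroSeq_pos_lt_one n).1)]
    simp [norm_zeroSeq]
  simp only [hf]
  refine le_trans ?_ (s.one_sub_sum_le_prod_one_sub (fun _ => by positivity)
    fun n => (one_div_sixteen_pow_le n).trans (by norm_num))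
  have := (summable_pow_pnat (r := 1 / 16) (by norm_num) (by norm_num)).sum_le_tsum s
    fun _ _ => by positivity
  linarith

lemma one_sub_blaschkeB₁_ne_zero {z : ℂ} (hz : ‖z‖ < 1) : 1 - blaschkeB₁ z ≠ 0 := by
  intro h
  have := norm_blaschkeB₁_lt_one hz
  rw [← sub_eq_zero.mp h, norm_one] at this
  exact lt_irrefl _ this

lemma hasDerivAt_div_one_sub_sq {B : ℂ → ℂ} {B' z : ℂ} (hB : HasDerivAt B B' z)
    (h : 1 - B z ≠ 0) :
    HasDerivAt (fun z => z / (1 - B z) ^ 2) (1 / (1 - B z) ^ 2 + 2 * z * B' / (1 - B z) ^ 3) z := by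
  have h1 := (hasDerivAt_id z).div ((hB.const_sub 1).pow 2) (pow_ne_zero 2 h)
  refine h1.congr_deriv ?_
  simp only [id_eq, Pi.pow_apply, Nat.cast_ofNat, Nat.add_one_sub_one, pow_one]
  field_simp
  ring

lemma div_one_sub_blaschkeB₁_sq_mem_classA :
    (fun z : ℂ => z / (1 - blaschkeB₁ z) ^ 2) ∈ classA := by
  refine ⟨?_, by simp, ?_⟩
  · refine DifferentiableOn.analyticOnNhd ?_ Metric.isOpen_ball
    refine differentiableOn_id.div ((differentiableOn_blaschkeB₁.const_sub 1).pow 2) fun z hz => ?_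
    exact pow_ne_zero 2 (one_sub_blaschkeB₁_ne_zero (mem_ball_zero_iff.mp hz))
  · have h0 : blaschkeB₁ 0 = 0 := by simp [blaschkeB₁]
    have hd := (differentiableOn_blaschkeB₁.differentiableAt
      (Metric.ball_mem_nhds (0 : ℂ) one_pos)).hasDerivAt
    rw [(hasDerivAt_div_one_sub_sq hd (one_sub_blaschkeB₁_ne_zero (by simp))).deriv, h0]
    simp

lemma div_one_sub_blaschkeB₁_sq_notMem_classU :
    (fun z : ℂ => z / (1 - blaschkeB₁ z) ^ 2) ∉ classU 1 := by
  rintro ⟨-, hU⟩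
  set b : ℂ → ℂ := fun z => ∏' n : ℕ+, blaschkeFactor (zeroSeq n) z with hb
  have hBb : ∀ z, blaschkeB₁ z = z * b z := fun _ => rfl
  have hbd : DifferentiableOn ℂ b (Metric.ball 0 1) :=
    differentiableOn_tprod_blaschkeFactor norm_zeroSeq_pos_lt_one summable_one_sub_norm_zeroSeq
  set g : ℂ → ℂ := fun z => b z * (z * b z - 2) with hg
  have hgd : DifferentiableOn ℂ g (Metric.ball 0 1) :=
    hbd.mul ((differentiableOn_id.mul hbd).sub_const 2)
  have hderiv : ∀ z : ℂ, ‖z‖ < 1 → z ≠ 0 → ‖z‖ ^ 2 * ‖deriv g z‖ < 1 := by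
    intro z hz hz0
    have hmem : z ∈ Metric.ball (0 : ℂ) 1 := mem_ball_zero_iff.mpr hz
    have hbz := (hbd.differentiableAt (Metric.isOpen_ball.mem_nhds hmem)).hasDerivAt
    have hBz : HasDerivAt blaschkeB₁ (b z + z * deriv b z) z := by
      simpa using! (hasDerivAt_id z).mul hbz
    have hgz : HasDerivAt g (deriv b z * (z * b z - 2) + b z * (b z + z * deriv b z)) z :=
      hbz.mul (hBz.sub_const 2)
    have hne := one_sub_blaschkeB₁_ne_zero hz
    have h1 := (hU z hmem hz0).2
    rw [(hasDerivAt_div_one_sub_sq hBz hne).deriv] at h1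
    simp only [hBb] at h1 hne
    have h2 : (z / (z / (1 - z * b z) ^ 2)) ^ 2 * (1 / (1 - z * b z) ^ 2 +
        2 * z * (b z + z * deriv b z) / (1 - z * b z) ^ 3) - 1 = -(z ^ 2 * deriv g z) := by
      rw [hgz.deriv]
      field_simp
      ring
    rwa [h2, norm_neg, norm_mul, norm_pow] at h1
  have hsub : Metric.closedBall (0 : ℂ) (15 / 16) ⊆ Metric.ball 0 1 :=
    Metric.closedBall_subset_ball (by norm_num)
  -- The factor `|z|²` degenerates near `0`, so the bound is taken on the circle `|z| = 15/16 =
  -- |a_1|` and carried inward by the maximum principle.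
  have hbound : ∀ z ∈ Metric.closedBall (0 : ℂ) (15 / 16), ‖deriv g z‖ ≤ (16 / 15) ^ 2 := by
    intro z hz
    refine Complex.norm_le_of_forall_mem_frontier_norm_le (f := deriv g)
      (U := Metric.ball 0 (15 / 16)) Metric.isBounded_ball ?_ (fun y hy => ?_) ?_
    · refine DifferentiableOn.diffContOnCl ?_
      rw [closure_ball _ (by norm_num)]
      exact (hgd.deriv Metric.isOpen_ball).mono hsub
    · rw [frontier_ball _ (by norm_num), mem_sphere_zero_iff_norm] at hy
      have h1 := hderiv y (by rw [hy]; norm_num) (by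
        rw [← norm_ne_zero_iff, hy]
        norm_num)
      rw [hy] at h1
      linarith
    · rwa [closure_ball _ (by norm_num)]
  have hz1 : zeroSeq 1 ∈ Metric.closedBall (0 : ℂ) (15 / 16) := by
    rw [mem_closedBall_zero_iff, norm_zeroSeq]
    norm_num
  have hlip := (convex_closedBall (0 : ℂ) (15 / 16)).norm_image_sub_le_of_norm_deriv_le
    (fun z hz => hgd.differentiableAt (Metric.isOpen_ball.mem_nhds (hsub hz))) hbound hz1
    (Metric.mem_closedBall_self (by norm_num))
  have hg1 : g (zeroSeq 1) = 0 := by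
    have : b (zeroSeq 1) = 0 := tprod_of_exists_eq_zero ⟨1, by simp [blaschkeFactor]⟩
    simp [hg, this]
  have hg0 : ‖g 0‖ = ‖b 0‖ * 2 := by simp [hg]
  -- The contradiction: `28/15 ≤ 2 |b(0)| = |g(0) - g(a_1)| ≤ (16/15)² · 15/16 = 16/15`.
  rw [hg1, sub_zero, zero_sub, norm_neg, hg0] at hlip
  have hb0 : 14 / 15 ≤ ‖b 0‖ := le_norm_tprod_blaschkeFactor_zero
  rw [mem_closedBall_zero_iff] at hz1
  linarith

theorem mainTheorem12 :
    -- `B₁` is a Blaschke product: zeros in the disk, Blaschke condition, convergence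
    ((∀ n : ℕ+, 0 < ‖zeroSeq n‖ ∧ ‖zeroSeq n‖ < 1) ∧
      Summable (fun n : ℕ+ => 1 - ‖zeroSeq n‖) ∧
      MultipliableLocallyUniformlyOn (fun (n : ℕ+) (z : ℂ) => blaschkeFactor (zeroSeq n) z)
        (Metric.ball 0 1) ∧
      ∀ S : Set ℕ+,
        MultipliableLocallyUniformlyOn (fun (n : S) (z : ℂ) => blaschkeFactor (zeroSeq n) z)
          (Metric.ball 0 1)) ∧
    -- (a) unimodular radial limits everywhere, for `B₁` and all its subproducts
    ((∀ ζ : ℂ, ‖ζ‖ = 1 → ∃ w : ℂ, ‖w‖ = 1 ∧ HasRadialLimit blaschkeB₁ ζ w) ∧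
      ∀ (k : Fin 2) (S : Set ℕ+) (ζ : ℂ), ‖ζ‖ = 1 →
        ∃ w : ℂ, ‖w‖ = 1 ∧ HasRadialLimit (subproductB₁ k S) ζ w) ∧
    -- (b) finite angular derivative everywhere, with `1 < ζ B₁'(ζ) / B₁(ζ) < ∞`
    (∀ ζ : ℂ, ‖ζ‖ = 1 → ∃ w c : ℂ, HasAngularDerivAt blaschkeB₁ ζ w c ∧
      ‖w‖ = 1 ∧ ∃ x : ℝ, ζ * c / w = (x : ℂ) ∧ 1 < x) ∧
    -- (c) finite phase derivative everywhere
    (∀ t : ℝ, ∃ L : ℝ, HasPhaseDerivAt blaschkeB₁ t L) ∧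
    -- (d) `z / (1 - B₁(z))²` is a function of class `𝒜` that is not in `𝒰 = 𝒰(1)`
    ((fun z : ℂ => z / (1 - blaschkeB₁ z) ^ 2) ∈ classA ∧
      (fun z : ℂ => z / (1 - blaschkeB₁ z) ^ 2) ∉ classU 1) := by
  have hS : ∀ S : Set ℕ+, MultipliableLocallyUniformlyOn
      (fun (n : S) (z : ℂ) => blaschkeFactor (zeroSeq n) z) (Metric.ball 0 1) := fun S =>
    multipliableLocallyUniformlyOn_blaschkeFactor (fun n : S => norm_zeroSeq_pos_lt_one n)
      (summable_one_sub_norm_zeroSeq.subtype S)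
  refine ⟨⟨norm_zeroSeq_pos_lt_one, summable_one_sub_norm_zeroSeq,
    multipliableLocallyUniformlyOn_blaschkeFactor norm_zeroSeq_pos_lt_one
      summable_one_sub_norm_zeroSeq, hS⟩, ⟨fun ζ hζ => ?_, fun k S ζ hζ =>
      exists_hasRadialLimit_subproductB₁ k S hζ⟩,
    fun ζ hζ => exists_hasAngularDerivAt_blaschkeB₁ hζ, fun t => ?_,
    div_one_sub_blaschkeB₁_sq_mem_classA, div_one_sub_blaschkeB₁_sq_notMem_classU⟩
  · obtain ⟨w, c, h, hw, -⟩ := exists_hasAngularDerivAt_blaschkeB₁ hζ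
    exact ⟨w, hw, h.1.hasRadialLimit hζ⟩
  · obtain ⟨w, c, h, hw, -⟩ := exists_hasAngularDerivAt_blaschkeB₁
      (ζ := Complex.exp (Complex.I * t)) (by rw [mul_comm, Complex.norm_exp_ofReal_mul_I])
    refine ⟨_, h.hasPhaseDerivAt differentiableOn_blaschkeB₁ ?_⟩
    rw [← norm_ne_zero_iff, hw]
    exact one_ne_zero
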